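/- Let $\Omega$ be a finite nonempty alphabet with $A$ letters, let $k\ge 0$, and let $M(a\mid v)>0$ ($a\in\Omega$, $v\in\Omega^k$) be a $k$th-order Markov kernel with strictly positive entries, $\sum_{a\in\Omega}M(a\mid v)=1$ for every $v\in\Omega^k$. Let $\mathcal P(\Omega)$ be the set of strictly positive probability vectors on $\Omega$. Consider the time-homogeneous $k$th-order Markovian predictive game. Put $K_0=1$. In round $n=1,2,\dots$: Forecaster announces $p_n\in\mathcal P(\Omega)$, where $p_n(a)=M(a\mid\omega_{n-k}\cdots\omega_{n-1})$ for $n>k$, while the first $k$ forecasts are arbitrary (they may depend on the past moves of Reality); Skeptic announces $\alpha_n\in\mathbb R^\Omega$; Reality announces $\omega_n\in\Omega$; and \[ K_n=K_{n-1}\Bigl\{1+\sum_{a\in\Omega}\alpha_n(a)\bigl(\delta_{\omega_n}(a)-p_n(a)\bigr)\Bigr\}, \] where $\delta_{\omega_n}(a)=1$ if $\omega_n=a$ and $0$ otherwise. A strategy of Skeptic is called prudent if $K_n>0$ for all $n$ and all moves of Reality. Then there is exactly one probability distribution $\pi$ on $\Omega^k$ with $\pi(x_2\cdots x_{k+1})=\sum_{x_1\in\Omega}M(x_{k+1}\mid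 x_1\cdots x_k)\,\pi(x_1\cdots x_k)$ for all $x_2\cdots x_{k+1}\in\Omega^k$ (for $k=0$, $\pi$ is the point mass at the empty word), and $\pi>0$. For $\ell\ge k$ and $a^\ell=a_1\cdots a_\ell\in\Omega^\ell$ put \[ P(a^\ell)=\pi(a_1\cdots a_k)\prod_{i=k+1}^{\ell}M(a_i\mid a_{i-k}\cdots a_{i-1}), \] and let $S_n(a^\ell)$ be the number of (possibly overlapping) occurrences of $a^\ell$ in $\omega_1\cdots\omega_n$. Call $\omega_1\omega_2\cdots$ normal if $\lim_{n\to\infty}S_n(a^\ell)/n=P(a^\ell)$ for all $\ell\ge k$ and all $a^\ell\in\Omega^\ell$. (1) Skeptic has a strategy $\alpha:\Omega^*\to\mathbb R^\Omega$, $\alpha_n=\alpha(\omega_1\cdots\omega_{n-1})$, depending only on $M$ (not on Forecaster's first $k$ announcements), that is prudent and ensures $\lim_{n\to\infty}K_n=\infty$ unless $\omega_1\omega_2\cdots$ is normal. (2) The Lempel–Ziv betting strategy with banked gains is prudent and ensures $\lim_{n\to\infty}K_n=\infty$ unless $\omega_1\omega_2\cdots$ is normal. It is defined as follows. Parse $w=\omega_1\cdots\omega_{n-1}$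 incrementally from left to right, closing the current phrase as soon as it differs from all phrases closed before; let $\Phi$ be the set of closed phrases together with the empty word, let $\xi_0$ be the unfinished (possibly empty) last phrase, and let $V=\{ub: u\in\Phi,\ b\in\Omega\}\setminus\Phi$. Let \[ Q_{LZ}(a\mid w)=\frac{|\{\xi\in V:\ \xi_0a\text{ is a prefix of }\xi\}|}{|\{\xi\in V:\ \xi_0\text{ is a prefix of }\xi\}|}. \] The Lempel–Ziv betting strategy is $\alpha_n(a)=Q_{LZ}(a\mid\omega_1\cdots\omega_{n-1})/p_n(a)$. Its version with banked gains splits the capital into an amount in play (initially $1$) and an amount put aside (initially $0$); the bets $\alpha_n$ are applied to the amount in play only, and whenever after a round the amount in play is at least $2$, all of it except $1$ is put aside for good and the play goes on with $1$. Its capital $K_n$ is the sum of the two amounts. -/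

import Mathlib

open Filter Topology

namespace PredictiveGame

noncomputable section

variable {Ω : Type*} [Fintype Ω] [DecidableEq Ω]

/-! ### Markov kernels, stationary distributions, normal sequences -/

/-- A forecast: a strictly positive probability vector on the finite alphabet `Ω`. -/
def IsForecast (q : Ω → ℝ) : Prop :=
  (∀ a, 0 < q a) ∧ ∑ a, q a = 1

/-- `M a v` is the probability `M(a ∣ v)` of the letter `a` after the word `v` of length `k`. -/
def IsKernel {k : ℕ} (M : Ω → (Fin k → Ω) → ℝ) : Prop :=
  ∀ v, IsForecast (fun a => M a v)

/-- `π` is a probability distribution on words of length `k` with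
`π(x₂ ⋯ x_{k+1}) = ∑_{x₁} M(x_{k+1} ∣ x₁ ⋯ x_k) π(x₁ ⋯ x_k)`; below, `v` is `x₂ ⋯ x_{k+1}`, and
`Fin.cons c v` is the word `x₁ ⋯ x_{k+1}` with `x₁ = c`. -/
def IsStationary {k : ℕ} (M : Ω → (Fin k → Ω) → ℝ) (π : (Fin k → Ω) → ℝ) : Prop :=
  (∀ v, 0 ≤ π v) ∧ ∑ v, π v = 1 ∧
    ∀ v : Fin k → Ω, π v =
      ∑ c : Ω, (fun x : Fin (k + 1) → Ω => M (x (Fin.last k)) (Fin.init x) * π (Fin.init x))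
        (Fin.cons c v)

/-- `P(a₁ ⋯ a_ℓ) = π(a₁ ⋯ a_k) ∏_{i=k+1}^{ℓ} M(a_i ∣ a_{i-k} ⋯ a_{i-1})` for `ℓ ≥ k`; letters are
numbered from `0` here. -/
def jointProb {k : ℕ} (M : Ω → (Fin k → Ω) → ℝ) (π : (Fin k → Ω) → ℝ) {ℓ : ℕ} (h : k ≤ ℓ)
    (a : Fin ℓ → Ω) : ℝ :=
  π (fun j => a ⟨j, by omega⟩) *
    ∏ i : Fin (ℓ - k), M (a ⟨i + k, by omega⟩) (fun j => a ⟨i + j, by omega⟩)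

/-- `S_n(a)`: the number of (possibly overlapping) occurrences of the word `a` of length `ℓ` in the
first `n` letters `ω 0, …, ω (n - 1)` of the sequence `ω`. -/
def occurrences (ω : ℕ → Ω) (n : ℕ) {ℓ : ℕ} (a : Fin ℓ → Ω) : ℕ :=
  ((Finset.range (n + 1)).filter (fun i => i + ℓ ≤ n ∧ ∀ j : Fin ℓ, ω (i + j) = a j)).card

/-- The frequency of every word of length at least `k` converges to its stationary joint
probability. -/
def IsNormal {k : ℕ} (M : Ω → (Fin k → Ω) → ℝ) (π : (Fin k → Ω) → ℝ) (ω : ℕ → Ω) : Prop :=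
  ∀ (ℓ : ℕ) (h : k ≤ ℓ) (a : Fin ℓ → Ω),
    Tendsto (fun n : ℕ => (occurrences ω n a : ℝ) / n) atTop (𝓝 (jointProb M π h a))

/-! ### The game

Finite histories of Reality's moves are lists in chronological order. Both Forecaster's
announcements `p` and Skeptic's strategy `α` are functions of Reality's past moves. -/

/-- Forecaster announces elements of `𝒫(Ω)`, and from round `k + 1` on these are given by the kernel
`M` applied to the last `k` moves of Reality. The first `k` forecasts are free. -/
def FollowsKernel {k : ℕ} (M : Ω → (Fin k → Ω) → ℝ) (p : List Ω → Ω → ℝ) : Prop :=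
  (∀ w, IsForecast (p w)) ∧
    ∀ (u : List Ω) (v : Fin k → Ω) (a : Ω), p (u ++ List.ofFn v) a = M a v

/-- The factor `1 + ∑ₐ α(w)(a) (δ_x(a) - p(w)(a))` by which the capital is multiplied when Reality
plays `x` after the history `w`. -/
def gain (p α : List Ω → Ω → ℝ) (w : List Ω) (x : Ω) : ℝ :=
  1 + ∑ a, α w a * ((if x = a then 1 else 0) - p w a)

/-- The history formed by the first `n` moves of `ω`. -/
def history (ω : ℕ → Ω) (n : ℕ) : List Ω :=
  List.ofFn (fun i : Fin n => ω i)

/-- Skeptic's capital `K_n`. -/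
def capital (p α : List Ω → Ω → ℝ) (ω : ℕ → Ω) : ℕ → ℝ
  | 0 => 1
  | n + 1 => capital p α ω n * gain p α (history ω n) (ω n)

def IsPrudent (p α : List Ω → Ω → ℝ) : Prop :=
  ∀ (ω : ℕ → Ω) (n : ℕ), 0 < capital p α ω n

/-- Against the forecasts `p`, the strategy `α` is prudent and ensures `K_n → ∞` unless Reality's
moves satisfy `E`. -/
def Ensures (p α : List Ω → Ω → ℝ) (E : (ℕ → Ω) → Prop) : Prop :=
  IsPrudent p α ∧ ∀ ω : ℕ → Ω, ¬ E ω → Tendsto (capital p α ω) atTop atTop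

/-! ### The Lempel–Ziv betting strategy -/

/-- State of incremental parsing: the set of phrases parsed so far, and the current unfinished
phrase. -/
structure Parse (Ω : Type*) where
  phrases : Finset (List Ω)
  current : List Ω

/-- Read one letter: the current phrase is closed as soon as it is a new one. -/
def Parse.step (s : Parse Ω) (x : Ω) : Parse Ω :=
  if s.current ++ [x] ∈ s.phrases then ⟨s.phrases, s.current ++ [x]⟩
  else ⟨insert (s.current ++ [x]) s.phrases, []⟩

def parse (w : List Ω) : Parse Ω :=
  w.foldl Parse.step ⟨∅, []⟩

/-- The set `V` of candidates for the next phrase: one-letter extensions of the empty word or of a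
parsed phrase that are not themselves parsed phrases. -/
def Parse.candidates (s : Parse Ω) : Finset (List Ω) :=
  ((insert [] s.phrases ×ˢ (Finset.univ : Finset Ω)).image (fun ub => ub.1 ++ [ub.2])) \
    insert [] s.phrases

/-- `Q_LZ(a ∣ w)`: the fraction of those candidates extending the unfinished phrase that continue
with the letter `a`. -/
def lzProb (w : List Ω) (a : Ω) : ℝ :=
  (((parse w).candidates.filter (fun ξ => (parse w).current ++ [a] <+: ξ)).card : ℝ) /
    (((parse w).candidates.filter (fun ξ => (parse w).current <+: ξ)).card : ℝ)

/-- The Lempel–Ziv betting strategy `α(w)(a) = Q_LZ(a ∣ w) / p(w)(a)`. -/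
def lzStrategy (p : List Ω → Ω → ℝ) (w : List Ω) (a : Ω) : ℝ :=
  lzProb w a / p w a

/-! ### Banking the gains -/

/-- The moves made so far, the money in play, and the money put aside. -/
structure Accounts (Ω : Type*) where
  past : List Ω
  active : ℝ
  storage : ℝ

/-- The money in play evolves under `α`; once it reaches or exceeds `2`, everything above `1` is put
aside and the game goes on with `1` in play. -/
def Accounts.step (p α : List Ω → Ω → ℝ) (s : Accounts Ω) (x : Ω) : Accounts Ω :=
  if 2 ≤ s.active * gain p α s.past x then
    ⟨s.past ++ [x], 1, s.storage + (s.active * gain p α s.past x - 1)⟩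
  else ⟨s.past ++ [x], s.active * gain p α s.past x, s.storage⟩

def accounts (p α : List Ω → Ω → ℝ) (w : List Ω) : Accounts Ω :=
  w.foldl (Accounts.step p α) ⟨[], 1, 0⟩

/-- The modification of `α` that bets with the money in play only. As bets are expressed as
multiples of the total capital, `α` is scaled by the proportion of the money in play. -/
def banked (p α : List Ω → Ω → ℝ) (w : List Ω) (a : Ω) : ℝ :=
  (accounts p α w).active / ((accounts p α w).active + (accounts p α w).storage) * α w a

end

end PredictiveGame

/-!
The capital of the Lempel–Ziv strategy is the likelihood ratio between the Lempel–Ziv probabilities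
and the forecasts. The phrases of the parsing are distinct words, so that their total probability
under a source that has lost a little mass is bounded, and their number is `o(n)`; hence the
likelihood of a Markovian source exceeds the Lempel–Ziv likelihood by a subexponential factor at
most. If, after some word `y`, the letter `a` does not come up as often as forecast, then the
forecasts tilted towards or away from `a` after `y` form a Markovian source whose likelihood beats
that of the forecasts exponentially at infinitely many times. So the Lempel–Ziv capital is
unbounded, and banking turns unbounded capital into capital that tends to infinity.

If instead all conditional frequencies agree with the forecasts, then the frequencies of words of
length `k` are asymptotically stationary, hence converge to `π`, the only stationary distribution,
and the frequencies of longer words follow by conditioning on all letters but the last.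
-/

namespace PredictiveGame

section FixedPoints

lemma exists_ne_zero_fixed_of_sum_map_eq {ι : Type*} [Fintype ι] [Nonempty ι]
    {T : (ι → ℝ) →ₗ[ℝ] (ι → ℝ)} (hsum : ∀ d, ∑ i, T d i = ∑ i, d i) :
    ∃ d, d ≠ 0 ∧ T d = d := by
  by_contra! h
  have hinj : Function.Injective (T - LinearMap.id : (ι → ℝ) →ₗ[ℝ] (ι → ℝ)) :=
    (injective_iff_map_eq_zero _).2 fun d hd => of_not_not fun hd0 => h d hd0 (sub_eq_zero.1 hd)
  obtain ⟨d, hd⟩ := LinearMap.injective_iff_surjective.1 hinj 1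
  have hd_sum : ∑ _i : ι, (1 : ℝ) = ∑ i, (T d i - d i) :=
    Finset.sum_congr rfl fun i _ => (congrFun hd i).symm
  simp [Finset.sum_sub_distrib, hsum] at hd_sum

lemma map_abs_eq_of_map_eq {ι : Type*} [Fintype ι] {T : (ι → ℝ) →ₗ[ℝ] (ι → ℝ)} (hT : Monotone T)
    (hsum : ∀ d, ∑ i, T d i = ∑ i, d i) {d : ι → ℝ} (hd : T d = d) : T |d| = |d| := by
  have hle : |d| ≤ T |d| :=
    abs_le'.2 ⟨hd.ge.trans (hT (le_abs_self d)),
      (hd ▸ map_neg T d).ge.trans (hT (neg_le_abs d))⟩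
  have heq := (Finset.sum_eq_sum_iff_of_le fun i _ => hle i).1 (hsum |d|).symm
  exact funext fun i => (heq i (Finset.mem_univ i)).symm

lemma exists_nonneg_fixed_sum_eq_one {ι : Type*} [Fintype ι] [Nonempty ι]
    {T : (ι → ℝ) →ₗ[ℝ] (ι → ℝ)} (hT : Monotone T) (hsum : ∀ d, ∑ i, T d i = ∑ i, d i) :
    ∃ d, 0 ≤ d ∧ ∑ i, d i = 1 ∧ T d = d := by
  obtain ⟨d, hd0, hd⟩ := exists_ne_zero_fixed_of_sum_map_eq hsum
  have hpos : 0 < ∑ i, |d| i := by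
    obtain ⟨i, hi⟩ := Function.ne_iff.1 hd0
    exact Finset.sum_pos' (fun j _ => abs_nonneg (d j)) ⟨i, Finset.mem_univ i, abs_pos.2 hi⟩
  refine ⟨(∑ i, |d| i)⁻¹ • |d|, smul_nonneg (inv_nonneg.2 hpos.le) (abs_nonneg d), ?_, ?_⟩
  · simp only [Pi.smul_apply, smul_eq_mul, ← Finset.mul_sum, inv_mul_cancel₀ hpos.ne']
  · rw [map_smul, map_abs_eq_of_map_eq hT hsum hd]

lemma exists_eq_smul_of_map_eq {ι : Type*} [Finite ι] {T : (ι → ℝ) →ₗ[ℝ] (ι → ℝ)}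
    (hirr : ∀ d, 0 ≤ d → T d = d → ∀ i, d i = 0 → d = 0) {d e : ι → ℝ} (hdpos : ∀ i, 0 < d i)
    (hd : T d = d) (he : T e = e) : ∃ t : ℝ, e = t • d := by
  cases isEmpty_or_nonempty ι
  · exact ⟨0, Subsingleton.elim _ _⟩
  -- The largest multiple of `d` below `e` agrees with `e` somewhere, hence everywhere.
  obtain ⟨i, hi⟩ := Finite.exists_min fun j => e j / d j
  refine ⟨e i / d i, sub_eq_zero.1 (hirr _ (fun j => ?_) ?_ i ?_)⟩
  · simpa using (le_div_iff₀ (hdpos j)).1 (hi j)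
  · rw [map_sub, map_smul, hd, he]
  · simp [(hdpos i).ne']

lemma tendsto_of_tendsto_map_sub_self {ι α : Type*} [Fintype ι] {T : (ι → ℝ) →ₗ[ℝ] (ι → ℝ)}
    {d : ι → ℝ} (hd : T d = d) (hd_sum : ∑ i, d i = 1) (hspan : ∀ e, T e = e → ∃ t : ℝ, e = t • d)
    {l : Filter α} {u : α → ι → ℝ} (hu : Tendsto (fun x => T (u x) - u x) l (𝓝 0))
    (hu_sum : Tendsto (fun x => ∑ i, u x i) l (𝓝 1)) : Tendsto u l (𝓝 d) := by
  let L : (ι → ℝ) →ₗ[ℝ] (ι → ℝ) × ℝ := (T - LinearMap.id).prod (∑ i, LinearMap.proj i)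
  have hL : ∀ e, L e = (T e - e, ∑ i, e i) := fun e => by simp [L]
  have hker : L.ker = ⊥ := by
    refine LinearMap.ker_eq_bot'.2 fun e he => ?_
    rw [hL, Prod.mk_eq_zero, sub_eq_zero] at he
    obtain ⟨t, rfl⟩ := hspan e he.1
    have ht : t = 0 := by simpa [← Finset.mul_sum, hd_sum] using he.2
    rw [ht, zero_smul]
  obtain ⟨R, hR⟩ := L.exists_leftInverse_of_injective hker
  have hRL : ∀ e, R (L e) = e := LinearMap.congr_fun hR
  have hLu : Tendsto (fun x => L (u x)) l (𝓝 (L d)) := by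
    simpa only [hL, hd, sub_self, hd_sum] using hu.prodMk_nhds hu_sum
  simpa only [Function.comp_def, hRL] using (R.continuous_of_finiteDimensional.tendsto _).comp hLu

end FixedPoints

section Stationary

variable {Ω : Type*} [Fintype Ω] {k : ℕ} {M : Ω → (Fin k → Ω) → ℝ}

lemma sum_words_cons {N : Type*} [AddCommMonoid N] (f : (Fin (k + 1) → Ω) → N) :
    ∑ v : Fin k → Ω, ∑ c, f (Fin.cons c v) = ∑ x, f x := by
  rw [Finset.sum_comm, ← Fintype.sum_prod_type']
  exact Fintype.sum_equiv (Fin.consEquiv fun _ : Fin (k + 1) => Ω) _ _ fun _ => rfl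

lemma sum_words_snoc {N : Type*} [AddCommMonoid N] (f : (Fin (k + 1) → Ω) → N) :
    ∑ v : Fin k → Ω, ∑ a, f (Fin.snoc v a) = ∑ x, f x := by
  rw [Finset.sum_comm, ← Fintype.sum_prod_type' (f := fun a (v : Fin k → Ω) => f (Fin.snoc v a))]
  exact Fintype.sum_equiv (Fin.snocEquiv fun _ : Fin (k + 1) => Ω) _ _ fun _ => rfl

/-- The measure on words of length `k + 1` obtained from a measure `d` on words of length `k` by
appending a letter with the kernel `M`. -/
def extendByKernel (M : Ω → (Fin k → Ω) → ℝ) (d : (Fin k → Ω) → ℝ) (x : Fin (k + 1) → Ω) : ℝ :=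
  M (x (Fin.last k)) (Fin.init x) * d (Fin.init x)

/-- The action of the kernel `M` on signed measures on words of length `k`: append a letter with `M`
and forget the first letter. The stationary distributions are its fixed probability vectors. -/
noncomputable def transfer (M : Ω → (Fin k → Ω) → ℝ) :
    ((Fin k → Ω) → ℝ) →ₗ[ℝ] ((Fin k → Ω) → ℝ) where
  toFun d v := ∑ c, extendByKernel M d (Fin.cons c v)
  map_add' d e := by
    ext v
    simp only [extendByKernel, Pi.add_apply, mul_add, Finset.sum_add_distrib]
  map_smul' r d := by
    ext v
    simp only [extendByKernel, Pi.smul_apply, smul_eq_mul, RingHom.id_apply, Finset.mul_sum,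
      mul_left_comm]

lemma transfer_apply (d : (Fin k → Ω) → ℝ) (v : Fin k → Ω) :
    transfer M d v = ∑ c, extendByKernel M d (Fin.cons c v) :=
  rfl

lemma isStationary_iff {d : (Fin k → Ω) → ℝ} :
    IsStationary M d ↔ 0 ≤ d ∧ ∑ v, d v = 1 ∧ transfer M d = d :=
  ⟨fun h => ⟨h.1, h.2.1, funext fun v => (h.2.2 v).symm⟩,
    fun h => ⟨h.1, h.2.1, fun v => (congrFun h.2.2 v).symm⟩⟩

lemma IsForecast.nonempty {q : Ω → ℝ} (hq : IsForecast q) : Nonempty Ω := by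
  by_contra! h
  simpa using hq.2

lemma sum_transfer (hM : IsKernel M) (d : (Fin k → Ω) → ℝ) :
    ∑ v, transfer M d v = ∑ v, d v := by
  simp only [transfer_apply]
  rw [sum_words_cons, ← sum_words_snoc]
  refine Finset.sum_congr rfl fun v _ => ?_
  simp only [extendByKernel, Fin.snoc_last, Fin.init_snoc, ← Finset.sum_mul, (hM v).2, one_mul]

lemma monotone_transfer (hM : IsKernel M) : Monotone (transfer M) := fun _ _ hde _ =>
  Finset.sum_le_sum fun _ _ => mul_le_mul_of_nonneg_left (hde _) ((hM _).1 _).le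

lemma transfer_window_pos (hM : IsKernel M) {d : (Fin k → Ω) → ℝ} (hd : 0 ≤ d) (x : ℕ → Ω)
    (hx : 0 < d fun j => x j) : 0 < transfer M d fun j => x (j + 1) := by
  have hcons : (Fin.cons (x 0) fun j : Fin k => x (j + 1)) = fun j : Fin (k + 1) => x j :=
    Fin.cons_self_tail fun j : Fin (k + 1) => x j
  refine Finset.sum_pos' (fun c _ => mul_nonneg ((hM _).1 _).le (hd _))
    ⟨x 0, Finset.mem_univ _, ?_⟩
  rw [hcons]
  exact mul_pos ((hM _).1 _) hx

lemma pos_of_transfer_eq (hM : IsKernel M) {d : (Fin k → Ω) → ℝ} (hd : 0 ≤ d)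
    (hT : transfer M d = d) {u : Fin k → Ω} (hu : 0 < d u) (v : Fin k → Ω) : 0 < d v := by
  -- Slide a window of length `k` along a sequence that starts with the letters of `u` and `v`.
  obtain ⟨c⟩ := (hM u).nonempty
  let x : ℕ → Ω := Function.extend Fin.val (Fin.append u v) fun _ => c
  have hx : ∀ j : Fin (k + k), x j = Fin.append u v j :=
    Fin.val_injective.extend_apply (Fin.append u v) _
  have hslide : ∀ i, 0 < d fun j : Fin k => x (i + j) := by
    intro i
    induction i with
    | zero =>
      have hxu : (fun j : Fin k => x (0 + j)) = u := funext fun j => by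
        simpa using hx (Fin.castAdd k j)
      rwa [hxu]
    | succ i ih =>
      rw [← hT]
      simpa only [add_assoc, add_comm 1] using transfer_window_pos hM hd (fun j => x (i + j)) ih
  have hxv : (fun j : Fin k => x (k + j)) = v := funext fun j =>
    (hx (Fin.natAdd k j)).trans (Fin.append_right u v j)
  exact hxv ▸ hslide k

lemma IsStationary.pos (hM : IsKernel M) {d : (Fin k → Ω) → ℝ} (h : IsStationary M d)
    (v : Fin k → Ω) : 0 < d v := by
  obtain ⟨hd, hd_sum, hT⟩ := isStationary_iff.1 h
  obtain ⟨u, -, hu⟩ : ∃ u ∈ Finset.univ, 0 < d u :=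
    Finset.exists_lt_of_sum_lt (by simp [hd_sum])
  exact pos_of_transfer_eq hM hd hT hu v

lemma IsStationary.exists_eq_smul (hM : IsKernel M) {d e : (Fin k → Ω) → ℝ}
    (hd : IsStationary M d) (he : transfer M e = e) : ∃ t : ℝ, e = t • d :=
  exists_eq_smul_of_map_eq
    (fun d hd hT v hv => by
      by_contra hne
      obtain ⟨u, hu⟩ := Function.ne_iff.1 hne
      exact (pos_of_transfer_eq hM hd hT ((hd u).lt_of_ne' hu) v).ne' hv)
    (hd.pos hM) (isStationary_iff.1 hd).2.2 he

lemma IsStationary.unique (hM : IsKernel M) {d e : (Fin k → Ω) → ℝ} (hd : IsStationary M d)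
    (he : IsStationary M e) : e = d := by
  obtain ⟨t, rfl⟩ := hd.exists_eq_smul hM (isStationary_iff.1 he).2.2
  have ht : t = 1 := by simpa [← Finset.mul_sum, hd.2.1] using he.2.1
  rw [ht, one_smul]

lemma exists_isStationary [Nonempty Ω] (hM : IsKernel M) : ∃ d, IsStationary M d :=
  (exists_nonneg_fixed_sum_eq_one (monotone_transfer hM) (sum_transfer hM)).imp fun _ =>
    isStationary_iff.2

end Stationary

section Histories

variable {Ω : Type*} {k : ℕ}

lemma history_add (ω : ℕ → Ω) (i m : ℕ) :
    history ω (i + m) = history ω i ++ List.ofFn fun j : Fin m => ω (i + j) := by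
  simp only [history, List.ofFn_add, Fin.val_natAdd, Fin.val_castLE]

lemma history_succ (ω : ℕ → Ω) (n : ℕ) : history ω (n + 1) = history ω n ++ [ω n] := by
  simp [history_add]

lemma length_history (ω : ℕ → Ω) (n : ℕ) : (history ω n).length = n :=
  List.length_ofFn

lemma exists_eq_append_ofFn {w : List Ω} (hw : k ≤ w.length) :
    ∃ (u : List Ω) (v : Fin k → Ω), w = u ++ List.ofFn v := by
  refine ⟨w.take (w.length - k), fun j => w[w.length - k + j], ?_⟩
  conv_lhs => rw [← w.take_append_drop (w.length - k)]
  congr 1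
  exact List.ext_getElem (by simpa using Nat.sub_sub_self hw) (by simp)

lemma ofFn_suffix_append_ofFn_iff {u : List Ω} {v v' : Fin k → Ω} :
    List.ofFn v <:+ u ++ List.ofFn v' ↔ v = v' := by
  have hlen : (List.ofFn v).length = (List.ofFn v').length := by simp
  simpa using List.suffix_append_inj_of_length_eq (l₁ := []) (l₂ := u) hlen

/-- The conditional distribution `q` of the next letter depends on the last `m` letters only; it is
unconstrained as long as there are fewer than `m` of them. -/
def IsMarkovian (m : ℕ) (q : List Ω → Ω → ℝ) : Prop :=
  ∀ u z, m ≤ z.length → q (u ++ z) = q z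

variable {M : Ω → (Fin k → Ω) → ℝ}

lemma jointProb_restrict {π : (Fin k → Ω) → ℝ} {ℓ : ℕ} (h : k ≤ ℓ) (x : ℕ → Ω) :
    jointProb M π h (fun j : Fin ℓ => x j) =
      π (fun j : Fin k => x j) * ∏ i ∈ Finset.range (ℓ - k), M (x (i + k)) fun j => x (i + j) := by
  rw [jointProb, Finset.prod_range]

lemma jointProb_restrict_succ {π : (Fin k → Ω) → ℝ} {ℓ : ℕ} (h : k ≤ ℓ) (x : ℕ → Ω) :
    jointProb M π (h.trans ℓ.le_succ) (fun j : Fin (ℓ + 1) => x j) =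
      M (x ℓ) (fun j : Fin k => x (ℓ - k + j)) * jointProb M π h fun j : Fin ℓ => x j := by
  rw [jointProb_restrict, jointProb_restrict, Nat.succ_sub h, Finset.prod_range_succ,
    Nat.sub_add_cancel h]
  ring

variable [Fintype Ω] {p q : List Ω → Ω → ℝ}

lemma FollowsKernel.isMarkovian (hp : FollowsKernel M p) : IsMarkovian k p := by
  intro u z hz
  obtain ⟨u', v, rfl⟩ := exists_eq_append_ofFn hz
  ext a
  rw [← List.append_assoc, hp.2, hp.2]

lemma FollowsKernel.apply_eq (hp : FollowsKernel M p) (hq : FollowsKernel M q) {w : List Ω}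
    (hw : k ≤ w.length) : p w = q w := by
  obtain ⟨u, v, rfl⟩ := exists_eq_append_ofFn hw
  ext a
  rw [hp.2, hq.2]

lemma FollowsKernel.apply_history_add (hp : FollowsKernel M p) (x : ℕ → Ω) (i : ℕ) (a : Ω) :
    p (history x (i + k)) a = M a fun j => x (i + j) := by
  rw [history_add, hp.2]

end Histories

section Frequencies

lemma tendsto_inv_natCast_mul_of_abs_le {f : ℕ → ℝ} {C : ℝ} (hf : ∀ n, |f n| ≤ C) :
    Tendsto (fun n : ℕ => (n : ℝ)⁻¹ * f n) atTop (𝓝 0) := by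
  simpa only [mul_comm] using
    bdd_le_mul_tendsto_zero' C (.of_forall hf) tendsto_inv_atTop_nhds_zero_nat

lemma tendsto_average_succ_sub_average {f : ℕ → ℝ} {C : ℝ} (hf : ∀ n, |f n| ≤ C) :
    Tendsto (fun n : ℕ => (n : ℝ)⁻¹ * ∑ i ∈ Finset.range n, f (i + 1) -
      (n : ℝ)⁻¹ * ∑ i ∈ Finset.range n, f i) atTop (𝓝 0) := by
  simp only [← mul_sub, ← Finset.sum_sub_distrib, Finset.sum_range_sub]
  exact tendsto_inv_natCast_mul_of_abs_le fun n =>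
    (abs_sub (f n) (f 0)).trans (add_le_add (hf n) (hf 0))

lemma tendsto_average_of_eventually_eq {f : ℕ → ℝ} {c : ℝ} {m : ℕ} (hf : ∀ n, m ≤ n → f n = c) :
    Tendsto (fun n : ℕ => (n : ℝ)⁻¹ * ∑ i ∈ Finset.range n, f i) atTop (𝓝 c) :=
  (tendsto_const_nhds.congr' ((eventually_ge_atTop m).mono fun n hn => (hf n hn).symm)).cesaro

variable {Ω : Type*} [DecidableEq Ω] {k : ℕ}

/-- The relative frequency of the occurrences of `y` among the end positions `0, …, n - 1` in the
sequence `ω`. -/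
noncomputable def suffixFreq (ω : ℕ → Ω) (y : List Ω) (n : ℕ) : ℝ :=
  (n : ℝ)⁻¹ * ∑ i ∈ Finset.range n, if y <:+ history ω i then 1 else 0

/-- When the next letter is `x` after the history `w`, the difference between the indicator of
`x = a` and its forecast probability, counted only if `w` ends with `y`. -/
noncomputable def excess (p : List Ω → Ω → ℝ) (y : List Ω) (a : Ω) (w : List Ω) (x : Ω) : ℝ :=
  if y <:+ w then (if x = a then 1 else 0) - p w a else 0

/-- The average excess over the first `n` rounds when Reality plays `ω`. -/
noncomputable def meanExcess (p : List Ω → Ω → ℝ) (y : List Ω) (a : Ω) (ω : ℕ → Ω) (n : ℕ) : ℝ :=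
  (n : ℝ)⁻¹ * ∑ i ∈ Finset.range n, excess p y a (history ω i) (ω i)

lemma abs_indicator_suffix_le (y w : List Ω) : |if y <:+ w then (1 : ℝ) else 0| ≤ 1 := by
  split_ifs <;> simp

lemma occurrences_eq_card_suffix (ω : ℕ → Ω) (n : ℕ) (v : Fin k → Ω) :
    occurrences ω n v = {i ∈ Finset.range (n + 1) | List.ofFn v <:+ history ω i}.card := by
  have hsuf : ∀ i, List.ofFn v <:+ history ω (i + k) ↔ ∀ j : Fin k, ω (i + j) = v j := fun i => by
    rw [history_add, ofFn_suffix_append_ofFn_iff, eq_comm, funext_iff]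
  have hlen : ∀ i, List.ofFn v <:+ history ω i → k ≤ i := fun i hi => by
    simpa [length_history] using hi.length_le
  refine Finset.card_nbij' (· + k) (· - k) (fun i hi => ?_) (fun i hi => ?_)
    (fun i _ => Nat.add_sub_cancel i k) fun i hi => ?_
  · simp only [Finset.coe_filter, Finset.mem_range, Set.mem_ofPred_eq, hsuf] at hi ⊢
    exact ⟨by lia, hi.2.2⟩
  · simp only [Finset.coe_filter, Finset.mem_range, Set.mem_ofPred_eq, ← hsuf] at hi ⊢
    rw [Nat.sub_add_cancel (hlen i hi.2)]
    exact ⟨by lia, by lia, hi.2⟩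
  · exact Nat.sub_add_cancel (hlen i (Finset.mem_filter.1 hi).2)

lemma tendsto_occurrences_div_sub_suffixFreq (ω : ℕ → Ω) (v : Fin k → Ω) :
    Tendsto (fun n : ℕ => (occurrences ω n v : ℝ) / n - suffixFreq ω (List.ofFn v) n) atTop
      (𝓝 0) := by
  refine (tendsto_inv_natCast_mul_of_abs_le fun n =>
    abs_indicator_suffix_le (List.ofFn v) (history ω n)).congr fun n => ?_
  rw [suffixFreq, occurrences_eq_card_suffix, Finset.card_filter, Nat.cast_sum,
    Finset.sum_range_succ]
  push_cast
  ring

lemma excess_history {m : ℕ} {p : List Ω → Ω → ℝ} (hp : IsMarkovian m p) (ω : ℕ → Ω) {y : List Ω}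
    (hy : m ≤ y.length) (a : Ω) (i : ℕ) :
    excess p y a (history ω i) (ω i) = (if y ++ [a] <:+ history ω (i + 1) then 1 else 0) -
      p y a * if y <:+ history ω i then 1 else 0 := by
  have hlen : [a].length = [ω i].length := rfl
  simp only [excess, history_succ, List.suffix_append_inj_of_length_eq hlen]
  by_cases hsuf : y <:+ history ω i
  · obtain ⟨u, hu⟩ := hsuf
    rw [← hu, hp u y hy]
    simp [eq_comm]
  · simp [hsuf]

lemma tendsto_suffixFreq_append_singleton_sub {m : ℕ} {p : List Ω → Ω → ℝ} (hp : IsMarkovian m p)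
    {ω : ℕ → Ω} {y : List Ω} (hy : m ≤ y.length) (a : Ω)
    (hexcess : Tendsto (meanExcess p y a ω) atTop (𝓝 0)) :
    Tendsto (fun n => suffixFreq ω (y ++ [a]) n - p y a * suffixFreq ω y n) atTop (𝓝 0) := by
  have hshift := tendsto_average_succ_sub_average fun n =>
    abs_indicator_suffix_le (y ++ [a]) (history ω n)
  refine ((hexcess.sub hshift).congr fun n => ?_).trans_eq (by rw [sub_zero])
  simp only [meanExcess, suffixFreq, excess_history hp ω hy, Finset.sum_sub_distrib,
    ← Finset.mul_sum]
  ring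

variable [Fintype Ω]

lemma sum_indicator_cons_suffix {y w : List Ω} (h : y.length < w.length) :
    ∑ c, (if c :: y <:+ w then (1 : ℝ) else 0) = if y <:+ w then 1 else 0 := by
  split_ifs with hsuf
  · obtain ⟨t, rfl⟩ := hsuf
    have ht : t ≠ [] := by rintro rfl; simp at h
    obtain ⟨t', d, rfl⟩ := t.eq_nil_or_concat'.resolve_left ht
    have hcons : ∀ c, c :: y <:+ t' ++ [d] ++ y ↔ c = d := fun c => by
      rw [← List.singleton_append, List.suffix_append_inj_of_length_eq rfl]
      simp
    simp only [hcons, Finset.sum_ite_eq', Finset.mem_univ, if_true]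
  · exact Finset.sum_eq_zero fun c _ => if_neg fun hc => hsuf ((List.suffix_cons c y).trans hc)

lemma sum_indicator_ofFn_suffix {w : List Ω} (hw : k ≤ w.length) :
    ∑ v : Fin k → Ω, (if List.ofFn v <:+ w then (1 : ℝ) else 0) = 1 := by
  obtain ⟨u, v, rfl⟩ := exists_eq_append_ofFn hw
  simp [ofFn_suffix_append_ofFn_iff]

lemma tendsto_sum_suffixFreq_cons_sub (ω : ℕ → Ω) (y : List Ω) :
    Tendsto (fun n => ∑ c, suffixFreq ω (c :: y) n - suffixFreq ω y n) atTop (𝓝 0) := by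
  refine (tendsto_average_of_eventually_eq (m := y.length + 1)
    (f := fun i => ∑ c, (if c :: y <:+ history ω i then (1 : ℝ) else 0) -
      if y <:+ history ω i then 1 else 0) fun n hn => ?_).congr fun n => ?_
  · exact sub_eq_zero.2 (sum_indicator_cons_suffix (by rwa [length_history]))
  · rw [Finset.sum_sub_distrib, Finset.sum_comm, mul_sub, Finset.mul_sum]
    rfl

lemma tendsto_sum_suffixFreq_ofFn (ω : ℕ → Ω) :
    Tendsto (fun n => ∑ v : Fin k → Ω, suffixFreq ω (List.ofFn v) n) atTop (𝓝 1) := by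
  refine (tendsto_average_of_eventually_eq (m := k) (f := fun i => ∑ v : Fin k → Ω,
    if List.ofFn v <:+ history ω i then (1 : ℝ) else 0) fun n hn => ?_).congr fun n => ?_
  · exact sum_indicator_ofFn_suffix (by rwa [length_history])
  · rw [Finset.sum_comm, Finset.mul_sum]
    rfl

variable {M : Ω → (Fin k → Ω) → ℝ} {π : (Fin k → Ω) → ℝ} {p : List Ω → Ω → ℝ}

lemma tendsto_suffixFreq_ofFn (hM : IsKernel M) (hπ : IsStationary M π) (hp : FollowsKernel M p)
    {ω : ℕ → Ω} (hexcess : ∀ (v : Fin k → Ω) (a : Ω),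
      Tendsto (meanExcess p (List.ofFn v) a ω) atTop (𝓝 0))
    (v : Fin k → Ω) : Tendsto (suffixFreq ω (List.ofFn v)) atTop (𝓝 (π v)) := by
  obtain ⟨-, hπ_sum, hπT⟩ := isStationary_iff.1 hπ
  have hsnoc : ∀ x : Fin (k + 1) → Ω, Tendsto (fun n => suffixFreq ω (List.ofFn x) n -
      extendByKernel M (fun v => suffixFreq ω (List.ofFn v) n) x) atTop (𝓝 0) := fun x => by
    have hx : List.ofFn x = List.ofFn (Fin.init x) ++ [x (Fin.last k)] := by
      rw [List.ofFn_succ', List.concat_eq_append]; rfl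
    have hpx : p (List.ofFn (Fin.init x)) (x (Fin.last k)) = M (x (Fin.last k)) (Fin.init x) :=
      hp.2 [] _ _
    simpa only [hx, hpx, extendByKernel] using
      tendsto_suffixFreq_append_singleton_sub hp.isMarkovian List.length_ofFn.ge (x (Fin.last k))
        (hexcess (Fin.init x) _)
  refine tendsto_pi_nhds.1 (tendsto_of_tendsto_map_sub_self hπT hπ_sum
    (fun e he => hπ.exists_eq_smul hM he) (tendsto_pi_nhds.2 fun v => ?_)
    (tendsto_sum_suffixFreq_ofFn ω)) v
  have hcons := (tendsto_sum_suffixFreq_cons_sub ω (List.ofFn v)).sub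
    (tendsto_finsetSum Finset.univ fun c _ => hsnoc (Fin.cons c v))
  refine (hcons.congr fun n => ?_).trans_eq (by simp)
  simp only [List.ofFn_cons, Finset.sum_sub_distrib, Pi.sub_apply, transfer_apply]
  ring

lemma tendsto_suffixFreq_history (hM : IsKernel M) (hπ : IsStationary M π) (hp : FollowsKernel M p)
    {ω : ℕ → Ω} (hexcess : ∀ (y : List Ω) (a : Ω), k ≤ y.length →
      Tendsto (meanExcess p y a ω) atTop (𝓝 0))
    (x : ℕ → Ω) {ℓ : ℕ} (h : k ≤ ℓ) :
    Tendsto (suffixFreq ω (history x ℓ)) atTop (𝓝 (jointProb M π h fun j : Fin ℓ => x j)) := by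
  induction ℓ, h using Nat.le_induction with
  | base =>
    simpa [jointProb_restrict, history] using
      tendsto_suffixFreq_ofFn hM hπ hp (fun v a => hexcess _ a (by simp)) fun j => x j
  | succ ℓ h ih =>
    have hpx : p (history x ℓ) (x ℓ) = M (x ℓ) fun j => x (ℓ - k + j) := by
      rw [← hp.apply_history_add, Nat.sub_add_cancel h]
    have hlen : k ≤ (history x ℓ).length := by rwa [length_history]
    have hsub := tendsto_suffixFreq_append_singleton_sub hp.isMarkovian hlen (x ℓ)
      (hexcess _ _ hlen)
    rw [jointProb_restrict_succ h, history_succ, ← hpx]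
    simpa using hsub.add (ih.const_mul (p (history x ℓ) (x ℓ)))

lemma isNormal_of_tendsto_excess (hM : IsKernel M) (hπ : IsStationary M π) (hp : FollowsKernel M p)
    {ω : ℕ → Ω} (hexcess : ∀ (y : List Ω) (a : Ω), k ≤ y.length →
      Tendsto (meanExcess p y a ω) atTop (𝓝 0)) :
    IsNormal M π ω := by
  intro ℓ h a
  obtain ⟨c⟩ := (hp.1 []).nonempty
  let x : ℕ → Ω := Function.extend Fin.val a fun _ => c
  have hx : (fun j : Fin ℓ => x j) = a := funext (Fin.val_injective.extend_apply a _)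
  have hfreq := tendsto_suffixFreq_history hM hπ hp hexcess x h
  rw [history, hx] at hfreq
  simpa using (tendsto_occurrences_div_sub_suffixFreq ω a).add hfreq

end Frequencies

section WordProbabilities

variable {Ω : Type*} {q : List Ω → Ω → ℝ}

/-- The probability that the word following the history `w` starts with `y`, when the next letter
has conditional distribution `q`. -/
noncomputable def wordProb (q : List Ω → Ω → ℝ) : List Ω → List Ω → ℝ
  | _, [] => 1
  | w, b :: y => q w b * wordProb q (w ++ [b]) y

lemma wordProb_nil (q : List Ω → Ω → ℝ) (w : List Ω) : wordProb q w [] = 1 :=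
  rfl

lemma wordProb_cons (q : List Ω → Ω → ℝ) (w : List Ω) (b : Ω) (y : List Ω) :
    wordProb q w (b :: y) = q w b * wordProb q (w ++ [b]) y :=
  rfl

lemma wordProb_append (q : List Ω → Ω → ℝ) (w y z : List Ω) :
    wordProb q w (y ++ z) = wordProb q w y * wordProb q (w ++ y) z := by
  induction y generalizing w with
  | nil => simp [wordProb_nil]
  | cons b y ih => simp [wordProb_cons, ih, mul_assoc]

lemma wordProb_append_singleton (q : List Ω → Ω → ℝ) (w : List Ω) (b : Ω) :
    wordProb q [] (w ++ [b]) = wordProb q [] w * q w b := by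
  simp [wordProb_append, wordProb_cons, wordProb_nil]

lemma wordProb_history (q : List Ω → Ω → ℝ) (ω : ℕ → Ω) (n : ℕ) :
    wordProb q [] (history ω n) = ∏ i ∈ Finset.range n, q (history ω i) (ω i) := by
  induction n with
  | zero => simp [history, wordProb_nil]
  | succ n ih => rw [history_succ, wordProb_append_singleton, ih, Finset.prod_range_succ]

lemma wordProb_pos (hq : ∀ w b, 0 < q w b) (w y : List Ω) : 0 < wordProb q w y := by
  induction y generalizing w with
  | nil => exact one_pos
  | cons b y ih => exact mul_pos (hq w b) (ih _)

lemma wordProb_nonneg (hq : ∀ w b, 0 ≤ q w b) (w y : List Ω) : 0 ≤ wordProb q w y := by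
  induction y generalizing w with
  | nil => exact zero_le_one
  | cons b y ih => exact mul_nonneg (hq w b) (ih _)

lemma wordProb_le_one (hq : ∀ w b, 0 ≤ q w b) (hq' : ∀ w b, q w b ≤ 1) (w y : List Ω) :
    wordProb q w y ≤ 1 := by
  induction y generalizing w with
  | nil => exact le_rfl
  | cons b y ih => exact mul_le_one₀ (hq' w b) (wordProb_nonneg hq _ _) (ih _)

lemma wordProb_const_mul (t : ℝ) (q : List Ω → Ω → ℝ) (w y : List Ω) :
    wordProb (fun w b => t * q w b) w y = t ^ y.length * wordProb q w y := by
  induction y generalizing w with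
  | nil => simp [wordProb_nil]
  | cons b y ih => simp only [wordProb_cons, ih, List.length_cons, pow_succ]; ring

lemma IsMarkovian.wordProb_append_left {m : ℕ} (hq : IsMarkovian m q) (u : List Ω) {z : List Ω}
    (hz : m ≤ z.length) (y : List Ω) : wordProb q (u ++ z) y = wordProb q z y := by
  induction y generalizing z with
  | nil => rfl
  | cons b y ih =>
    rw [wordProb_cons, wordProb_cons, hq u z hz, List.append_assoc, ih (by simp; lia)]

lemma IsMarkovian.exists_wordProb_eq {m : ℕ} (hq : IsMarkovian m q) (w : List Ω) :
    ∃ z : List Ω, z.length ≤ m ∧ wordProb q w = wordProb q z := by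
  rcases le_total w.length m with h | h
  · exact ⟨w, h, rfl⟩
  · have hlen : (w.drop (w.length - m)).length = m := by simp; lia
    refine ⟨w.drop (w.length - m), hlen.le, ?_⟩
    conv_lhs => rw [← w.take_append_drop (w.length - m)]
    exact funext (hq.wordProb_append_left _ hlen.ge)

lemma sum_wordProb_le_one_add_sum_tail [Fintype Ω] [DecidableEq Ω] (hq : ∀ w b, 0 ≤ q w b)
    (F : Finset (List Ω)) (w : List Ω) :
    ∑ y ∈ F, wordProb q w y ≤
      1 + ∑ b, q w b * ∑ y ∈ (F.erase []).image List.tail, wordProb q (w ++ [b]) y := by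
  set G := (F.erase []).image List.tail
  have hF : F ⊆ insert [] ((Finset.univ ×ˢ G).image fun z => z.1 :: z.2) := by
    rintro (_ | ⟨b, y⟩) hy
    · exact Finset.mem_insert_self _ _
    · have hyG : y ∈ G := Finset.mem_image.2 ⟨b :: y, by simp [hy], rfl⟩
      simp [hyG]
  refine (Finset.sum_le_sum_of_subset_of_nonneg hF fun y _ _ => wordProb_nonneg hq w y).trans_eq ?_
  rw [Finset.sum_insert (by simp), Finset.sum_image fun z _ z' _ h =>
    Prod.ext (List.cons.inj h).1 (List.cons.inj h).2, Finset.sum_product, wordProb_nil]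
  simp only [wordProb_cons, Finset.mul_sum]

lemma sum_wordProb_le [Fintype Ω] {t : ℝ} (ht : t < 1) (hq : ∀ w b, 0 ≤ q w b)
    (hsum : ∀ w, ∑ b, q w b ≤ t) (F : Finset (List Ω)) (w : List Ω) :
    ∑ y ∈ F, wordProb q w y ≤ (1 - t)⁻¹ := by
  classical
  have ht1 : 0 < 1 - t := sub_pos.2 ht
  obtain ⟨m, hm⟩ : ∃ m, ∀ y ∈ F, y.length < m :=
    ⟨F.sup List.length + 1, fun y hy => Nat.lt_succ_of_le (Finset.le_sup (f := List.length) hy)⟩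
  induction m generalizing F w with
  | zero =>
    rw [Finset.eq_empty_of_forall_notMem fun y hy => Nat.not_lt_zero _ (hm y hy), Finset.sum_empty]
    exact inv_nonneg.2 ht1.le
  | succ m ih =>
    have htail : ∀ y ∈ (F.erase []).image List.tail, y.length < m := by
      simp only [Finset.mem_image, Finset.mem_erase]
      rintro _ ⟨y, ⟨hy0, hyF⟩, rfl⟩
      have := hm y hyF
      have := List.length_pos_iff.2 hy0
      simp only [List.length_tail]
      lia
    calc ∑ y ∈ F, wordProb q w y
        ≤ 1 + ∑ b, q w b * ∑ y ∈ (F.erase []).image List.tail, wordProb q (w ++ [b]) y :=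
          sum_wordProb_le_one_add_sum_tail hq F w
      _ ≤ 1 + ∑ b, q w b * (1 - t)⁻¹ := by
          gcongr with b
          · exact hq w b
          · exact ih _ (w ++ [b]) htail
      _ ≤ 1 + t * (1 - t)⁻¹ := by
          rw [← Finset.sum_mul]
          gcongr
          exact hsum w
      _ = (1 - t)⁻¹ := by field_simp; ring

lemma factorial_card_mul_prod_le {ι : Type*} {F : Finset ι} {g : ι → ℝ} (hg : ∀ i ∈ F, 0 ≤ g i) :
    (F.card.factorial : ℝ) * ∏ i ∈ F, g i ≤ (∑ i ∈ F, g i) ^ F.card := by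
  rcases F.eq_empty_or_nonempty with rfl | hF
  · simp
  have hcard : (0 : ℝ) < F.card := by exact_mod_cast hF.card_pos
  have hprod : 0 ≤ ∏ i ∈ F, g i := Finset.prod_nonneg hg
  have hamgm : (∏ i ∈ F, g i) ^ (F.card : ℝ)⁻¹ ≤ (∑ i ∈ F, g i) / F.card := by
    simpa using Real.geom_mean_le_arith_mean F 1 g (by simp) (by simpa using hF) hg
  calc (F.card.factorial : ℝ) * ∏ i ∈ F, g i
      ≤ (F.card : ℝ) ^ F.card * ∏ i ∈ F, g i := by
        gcongr
        exact_mod_cast Nat.factorial_le_pow F.card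
    _ = ((F.card : ℝ) * (∏ i ∈ F, g i) ^ (F.card : ℝ)⁻¹) ^ F.card := by
        rw [mul_pow, Real.rpow_inv_natCast_pow hprod hF.card_ne_zero]
    _ ≤ (∑ i ∈ F, g i) ^ F.card := by
        gcongr
        rwa [← le_div_iff₀' hcard]

end WordProbabilities

section LempelZiv

variable {Ω : Type*} [DecidableEq Ω]

lemma parse_append_singleton (w : List Ω) (x : Ω) : parse (w ++ [x]) = (parse w).step x := by
  simp [parse]

lemma parse_current_mem (w : List Ω) : (parse w).current ∈ insert [] (parse w).phrases := by
  induction w using List.reverseRecOn with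
  | nil => simp [parse]
  | append_singleton w x _ =>
    rw [parse_append_singleton, Parse.step]
    split_ifs with hmem
    · exact Finset.mem_insert_of_mem hmem
    · exact Finset.mem_insert_self _ _

lemma length_eq_sum_length_phrases_add (w : List Ω) :
    w.length = ∑ y ∈ (parse w).phrases, y.length + (parse w).current.length := by
  induction w using List.reverseRecOn with
  | nil => simp [parse]
  | append_singleton w x ih =>
    rw [parse_append_singleton, Parse.step]
    split_ifs with hmem
    · simp [ih, add_assoc]
    · simp only [List.length_append, ih, Finset.sum_insert hmem, List.length_nil]
      ring

lemma exists_wordProb_le_prod_phrases {q : List Ω → Ω → ℝ} (hq : ∀ w b, 0 ≤ q w b)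
    {S : Finset (List Ω)} (hS : ∀ w, ∃ s ∈ S, wordProb q w = wordProb q s) (w : List Ω) :
    ∃ w₀, w = w₀ ++ (parse w).current ∧
      wordProb q [] w₀ ≤ ∏ y ∈ (parse w).phrases, ∑ s ∈ S, wordProb q s y := by
  induction w using List.reverseRecOn with
  | nil => exact ⟨[], by simp [parse, wordProb_nil]⟩
  | append_singleton w x ih =>
    obtain ⟨w₀, hw, hle⟩ := ih
    have hw' : w ++ [x] = w₀ ++ ((parse w).current ++ [x]) := by rw [← List.append_assoc, ← hw]
    rw [parse_append_singleton, Parse.step]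
    split_ifs with hmem
    · exact ⟨w₀, hw', hle⟩
    · refine ⟨w ++ [x], (List.append_nil _).symm, ?_⟩
      obtain ⟨s, hs, heq⟩ := hS w₀
      have hphrase : wordProb q w₀ ((parse w).current ++ [x]) ≤
          ∑ s ∈ S, wordProb q s ((parse w).current ++ [x]) := by
        rw [heq]
        exact Finset.single_le_sum (fun s _ => wordProb_nonneg hq s _) hs
      rw [Finset.prod_insert hmem, hw', wordProb_append, List.nil_append, mul_comm]
      exact mul_le_mul hphrase hle (wordProb_nonneg hq _ _)
        (Finset.sum_nonneg fun s _ => wordProb_nonneg hq s _)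

lemma mul_card_le_sum_length_add {Ω : Type*} [Finite Ω] (F : Finset (List Ω)) (m : ℕ) :
    m * F.card ≤ ∑ y ∈ F, y.length + m * (List.finite_length_le Ω m).toFinset.card := by
  have hshort : (F.filter fun y => y.length ≤ m) ⊆ (List.finite_length_le Ω m).toFinset :=
    fun y hy => by simpa using (Finset.mem_filter.1 hy).2
  calc m * F.card = ∑ _y ∈ F, m := by rw [Finset.sum_const, smul_eq_mul, mul_comm]
    _ ≤ ∑ y ∈ F, (y.length + if y.length ≤ m then m else 0) :=
        Finset.sum_le_sum fun y _ => by split_ifs <;> lia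
    _ = ∑ y ∈ F, y.length + m * (F.filter fun y => y.length ≤ m).card := by
        rw [Finset.sum_add_distrib, ← Finset.sum_filter, Finset.sum_const, smul_eq_mul, mul_comm m]
    _ ≤ ∑ y ∈ F, y.length + m * (List.finite_length_le Ω m).toFinset.card := by
        gcongr

lemma isLittleO_card_phrases [Finite Ω] (ω : ℕ → Ω) :
    (fun n => ((parse (history ω n)).phrases.card : ℝ)) =o[atTop] fun n : ℕ => (n : ℝ) := by
  refine Asymptotics.isLittleO_iff.2 fun ε hε => ?_
  obtain ⟨m, hm⟩ := exists_nat_gt (2 / ε)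
  have hm0 : (0 : ℝ) < m := lt_trans (by positivity) hm
  have hmε : 2 < m * ε := (div_lt_iff₀ hε).1 hm
  set N : ℕ := m * (List.finite_length_le Ω m).toFinset.card
  filter_upwards [eventually_ge_atTop N] with n hn
  have hlen := length_eq_sum_length_phrases_add (history ω n)
  rw [length_history] at hlen
  have hcard : m * (parse (history ω n)).phrases.card ≤ 2 * n := by
    have := mul_card_le_sum_length_add (parse (history ω n)).phrases m
    lia
  rw [RCLike.norm_natCast, RCLike.norm_natCast]
  refine le_of_mul_le_mul_left ?_ hm0
  calc (m : ℝ) * (parse (history ω n)).phrases.card ≤ 2 * n := by exact_mod_cast hcard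
    _ ≤ m * ε * n := by gcongr
    _ = m * (ε * n) := mul_assoc _ _ _

lemma eventually_mul_pow_card_phrases_le_exp [Finite Ω] {C D δ : ℝ} (hC : 0 < C) (hD : 0 < D)
    (hδ : 0 < δ) (ω : ℕ → Ω) :
    ∀ᶠ n : ℕ in atTop, C * D ^ (parse (history ω n)).phrases.card ≤ Real.exp (δ * n) := by
  have hlog : (fun n => Real.log C + Real.log D * (parse (history ω n)).phrases.card) =o[atTop]
      fun n : ℕ => (n : ℝ) :=
    ((Asymptotics.isLittleO_const_id_atTop _).comp_tendsto tendsto_natCast_atTop_atTop).add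
      ((isLittleO_card_phrases ω).const_mul_left _)
  filter_upwards [hlog.def hδ] with n hn
  rw [RCLike.norm_natCast] at hn
  rw [← Real.exp_log hC, ← Real.exp_log hD, ← Real.exp_nat_mul, ← Real.exp_add, mul_comm (_ : ℝ)]
  exact Real.exp_le_exp.2 ((le_abs_self _).trans hn)

variable [Fintype Ω]

lemma Parse.mem_candidates {s : Parse Ω} {ξ : List Ω} :
    ξ ∈ s.candidates ↔
      (∃ u ∈ insert [] s.phrases, ∃ b, u ++ [b] = ξ) ∧ ξ ∉ insert [] s.phrases := by
  simp only [Parse.candidates, Finset.mem_sdiff, Finset.mem_image, Finset.mem_product,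
    Finset.mem_univ, and_true, Prod.exists, exists_and_left]

lemma Parse.card_candidates_le (s : Parse Ω) :
    s.candidates.card ≤ Fintype.card Ω * (s.phrases.card + 1) :=
  calc s.candidates.card ≤ (insert [] s.phrases ×ˢ (Finset.univ : Finset Ω)).card :=
        (Finset.card_le_card Finset.sdiff_subset).trans Finset.card_image_le
    _ = Fintype.card Ω * (insert [] s.phrases).card := by
        rw [Finset.card_product, Finset.card_univ, mul_comm]
    _ ≤ Fintype.card Ω * (s.phrases.card + 1) :=
        Nat.mul_le_mul_left _ (Finset.card_insert_le _ _)

/-- The number of candidates for the next phrase that extend `ξ`; the Lempel–Ziv probabilities are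
ratios of such numbers. -/
def Parse.extensions (s : Parse Ω) (ξ : List Ω) : ℕ :=
  (s.candidates.filter fun η => ξ <+: η).card

lemma lzProb_eq (w : List Ω) (a : Ω) :
    lzProb w a = ((parse w).extensions ((parse w).current ++ [a]) : ℝ) /
      ((parse w).extensions (parse w).current : ℝ) :=
  rfl

lemma Parse.extensions_nil (s : Parse Ω) : s.extensions [] = s.candidates.card := by
  simp [Parse.extensions]

lemma Parse.extensions_pos_of_mem_candidates {s : Parse Ω} {ξ : List Ω} (hξ : ξ ∈ s.candidates) :
    0 < s.extensions ξ :=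
  Finset.card_pos.2 ⟨ξ, Finset.mem_filter.2 ⟨hξ, List.prefix_rfl⟩⟩

lemma Parse.extensions_pos_of_mem_phrases [Nonempty Ω] {s : Parse Ω} {ξ : List Ω}
    (hξ : ξ ∈ insert [] s.phrases) : 0 < s.extensions ξ := by
  obtain ⟨b⟩ := ‹Nonempty Ω›
  -- A longest phrase extending `ξ`, followed by any letter, is a candidate.
  obtain ⟨u, hu, hmax⟩ := ((insert [] s.phrases).filter fun η => ξ <+: η).exists_max_image
    List.length ⟨ξ, Finset.mem_filter.2 ⟨hξ, List.prefix_rfl⟩⟩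
  obtain ⟨hu, hpre⟩ := Finset.mem_filter.1 hu
  have hpre' : ξ <+: u ++ [b] := hpre.trans (List.prefix_append u [b])
  have hnew : u ++ [b] ∉ insert [] s.phrases := fun hmem => by
    simpa using hmax (u ++ [b]) (Finset.mem_filter.2 ⟨hmem, hpre'⟩)
  exact Finset.card_pos.2
    ⟨u ++ [b], Finset.mem_filter.2 ⟨Parse.mem_candidates.2 ⟨⟨u, hu, b, rfl⟩, hnew⟩, hpre'⟩⟩

lemma extensions_current_pos [Nonempty Ω] (w : List Ω) :
    0 < (parse w).extensions (parse w).current :=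
  Parse.extensions_pos_of_mem_phrases (parse_current_mem w)

lemma extensions_current_append_pos [Nonempty Ω] (w : List Ω) (a : Ω) :
    0 < (parse w).extensions ((parse w).current ++ [a]) := by
  by_cases hmem : (parse w).current ++ [a] ∈ insert [] (parse w).phrases
  · exact Parse.extensions_pos_of_mem_phrases hmem
  · exact Parse.extensions_pos_of_mem_candidates
      (Parse.mem_candidates.2 ⟨⟨_, parse_current_mem w, a, rfl⟩, hmem⟩)

lemma Parse.sum_extensions {s : Parse Ω} {ξ : List Ω} (hξ : ξ ∈ insert [] s.phrases) :
    ∑ a, s.extensions (ξ ++ [a]) = s.extensions ξ := by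
  simp only [Parse.extensions, Finset.card_filter]
  rw [Finset.sum_comm]
  refine Finset.sum_congr rfl fun η hη => ?_
  by_cases hpre : ξ <+: η
  · obtain ⟨_ | ⟨c, t⟩, rfl⟩ := hpre
    · rw [List.append_nil] at hη
      exact absurd hξ (Parse.mem_candidates.1 hη).2
    · simp [List.prefix_append_right_inj]
  · rw [if_neg hpre]
    exact Finset.sum_eq_zero fun a _ => if_neg fun h => hpre ((List.prefix_append ξ [a]).trans h)

lemma isForecast_lzProb [Nonempty Ω] (w : List Ω) : IsForecast (lzProb w) := by
  have hpos : (0 : ℝ) < (parse w).extensions (parse w).current :=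
    Nat.cast_pos.2 (extensions_current_pos w)
  refine ⟨fun a => div_pos (Nat.cast_pos.2 (extensions_current_append_pos w a)) hpos, ?_⟩
  simp only [lzProb_eq, ← Finset.sum_div]
  rw [div_eq_one_iff_eq hpos.ne']
  exact_mod_cast Parse.sum_extensions (parse_current_mem w)

lemma wordProb_lzProb_pos [Nonempty Ω] (w : List Ω) : 0 < wordProb lzProb [] w :=
  wordProb_pos (fun w => (isForecast_lzProb w).1) [] w

-- Within a phrase the conditional probabilities telescope, and each closed phrase costs at most the
-- factor `card Ω * (c + 1)`, where `c` phrases have been closed.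
lemma extensions_current_le [Nonempty Ω] (w : List Ω) :
    ((parse w).extensions (parse w).current : ℝ) ≤ wordProb lzProb [] w *
      ((Fintype.card Ω : ℝ) ^ ((parse w).phrases.card + 1) *
        ((parse w).phrases.card + 1).factorial) := by
  induction w using List.reverseRecOn with
  | nil =>
    rw [wordProb_nil, one_mul]
    simpa [parse, Parse.extensions_nil] using (⟨∅, []⟩ : Parse Ω).card_candidates_le
  | append_singleton w x ih =>
    have hpos : (0 : ℝ) < (parse w).extensions (parse w).current :=
      Nat.cast_pos.2 (extensions_current_pos w)
    have hnext : ((parse w).extensions ((parse w).current ++ [x]) : ℝ) ≤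
        wordProb lzProb [] (w ++ [x]) * ((Fintype.card Ω : ℝ) ^ ((parse w).phrases.card + 1) *
          ((parse w).phrases.card + 1).factorial) := by
      rw [wordProb_append_singleton, lzProb_eq, mul_right_comm, mul_div_assoc',
        le_div_iff₀ hpos, mul_comm]
      gcongr
    rw [parse_append_singleton, Parse.step]
    split_ifs with hmem
    · exact hnext
    · have hone : (1 : ℝ) ≤ (parse w).extensions ((parse w).current ++ [x]) :=
        Nat.one_le_cast.2 (extensions_current_append_pos w x)
      have hcard := Parse.card_candidates_le
        ⟨insert ((parse w).current ++ [x]) (parse w).phrases, []⟩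
      rw [Finset.card_insert_of_notMem hmem] at hcard ⊢
      rw [Parse.extensions_nil, Nat.factorial_succ]
      set c := (parse w).phrases.card
      refine (Nat.cast_le.2 hcard).trans ?_
      calc ((Fintype.card Ω * (c + 1 + 1) : ℕ) : ℝ)
          ≤ (Fintype.card Ω * (c + 1 + 1) : ℕ) * (wordProb lzProb [] (w ++ [x]) *
            ((Fintype.card Ω : ℝ) ^ (c + 1) * (c + 1).factorial)) :=
            le_mul_of_one_le_right (Nat.cast_nonneg _) (hone.trans hnext)
        _ = _ := by
            push_cast
            ring

lemma factorial_card_phrases_mul_wordProb_le {q : List Ω → Ω → ℝ} {t : ℝ} (ht : t < 1)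
    (hq : ∀ w b, 0 ≤ q w b) (hsum : ∀ w, ∑ b, q w b ≤ t) {S : Finset (List Ω)}
    (hS : ∀ w, ∃ s ∈ S, wordProb q w = wordProb q s) (w : List Ω) :
    ((parse w).phrases.card.factorial : ℝ) * wordProb q [] w ≤
      (S.card * (1 - t)⁻¹) ^ (parse w).phrases.card := by
  have hq1 : ∀ w b, q w b ≤ 1 := fun w b =>
    (Finset.single_le_sum (fun b _ => hq w b) (Finset.mem_univ b)).trans ((hsum w).trans ht.le)
  have hg : ∀ y, 0 ≤ ∑ s ∈ S, wordProb q s y := fun y =>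
    Finset.sum_nonneg fun s _ => wordProb_nonneg hq s y
  set F := (parse w).phrases
  have hprod : wordProb q [] w ≤ ∏ y ∈ F, ∑ s ∈ S, wordProb q s y := by
    obtain ⟨w₀, hw, hle⟩ := exists_wordProb_le_prod_phrases hq hS w
    conv_lhs => rw [hw, wordProb_append]
    exact (mul_le_of_le_one_right (wordProb_nonneg hq _ _) (wordProb_le_one hq hq1 _ _)).trans hle
  have hsumF : ∑ y ∈ F, ∑ s ∈ S, wordProb q s y ≤ S.card * (1 - t)⁻¹ := by
    rw [Finset.sum_comm]
    exact (Finset.sum_le_sum fun s _ => sum_wordProb_le ht hq hsum F s).trans_eq (by simp)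
  calc (F.card.factorial : ℝ) * wordProb q [] w
      ≤ F.card.factorial * ∏ y ∈ F, ∑ s ∈ S, wordProb q s y := by gcongr
    _ ≤ (∑ y ∈ F, ∑ s ∈ S, wordProb q s y) ^ F.card := factorial_card_mul_prod_le fun y _ => hg y
    _ ≤ (S.card * (1 - t)⁻¹) ^ F.card :=
        pow_le_pow_left₀ (Finset.sum_nonneg fun y _ => hg y) hsumF _

lemma wordProb_le_mul_wordProb_lzProb [Nonempty Ω] {q : List Ω → Ω → ℝ} {t : ℝ} (ht : t < 1)
    (hq : ∀ w b, 0 ≤ q w b) (hsum : ∀ w, ∑ b, q w b ≤ t) {S : Finset (List Ω)}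
    (hS : ∀ w, ∃ s ∈ S, wordProb q w = wordProb q s) (w : List Ω) :
    wordProb q [] w ≤ Fintype.card Ω *
      (2 * Fintype.card Ω * (S.card * (1 - t)⁻¹)) ^ (parse w).phrases.card *
        wordProb lzProb [] w := by
  have hlz : 1 ≤ wordProb lzProb [] w * ((Fintype.card Ω : ℝ) ^ ((parse w).phrases.card + 1) *
      ((parse w).phrases.card + 1).factorial) :=
    (Nat.one_le_cast.2 (extensions_current_pos w)).trans (extensions_current_le w)
  have hlz0 := (wordProb_lzProb_pos w).le
  have hfact := factorial_card_phrases_mul_wordProb_le ht hq hsum hS w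
  have hB : 0 ≤ S.card * (1 - t)⁻¹ :=
    mul_nonneg (Nat.cast_nonneg _) (inv_nonneg.2 (sub_nonneg.2 ht.le))
  set c := (parse w).phrases.card
  set A : ℝ := (Fintype.card Ω : ℝ)
  set B : ℝ := S.card * (1 - t)⁻¹
  have htwo : (c + 1 : ℝ) ≤ 2 ^ c := by exact_mod_cast Nat.lt_two_pow_self
  calc wordProb q [] w
      ≤ wordProb q [] w * (wordProb lzProb [] w * (A ^ (c + 1) * (c + 1).factorial)) :=
        le_mul_of_one_le_right (wordProb_nonneg hq _ _) hlz
    _ = c.factorial * wordProb q [] w * ((c + 1) * (A ^ (c + 1) * wordProb lzProb [] w)) := by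
        rw [Nat.factorial_succ]
        push_cast
        ring
    _ ≤ B ^ c * (2 ^ c * (A ^ (c + 1) * wordProb lzProb [] w)) := by gcongr
    _ = A * (2 * A * B) ^ c * wordProb lzProb [] w := by ring

-- The phrases are distinct words, so their total probability under `exp (-δ / 2) • q` is bounded:
-- this is why the mass is first lowered a little.
theorem eventually_wordProb_le_exp_mul_wordProb_lzProb [Nonempty Ω] {q : List Ω → Ω → ℝ} {m : ℕ}
    (hq : ∀ w b, 0 ≤ q w b) (hsum : ∀ w, ∑ b, q w b ≤ 1) (hqm : IsMarkovian m q) {δ : ℝ}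
    (hδ : 0 < δ) (ω : ℕ → Ω) :
    ∀ᶠ n : ℕ in atTop, wordProb q [] (history ω n) ≤
      Real.exp (δ * n) * wordProb lzProb [] (history ω n) := by
  set t := Real.exp (-(δ / 2)) with ht_def
  have ht0 : 0 < t := Real.exp_pos _
  have ht1 : t < 1 := Real.exp_lt_one_iff.2 (by linarith)
  have htq : IsMarkovian m fun w b => t * q w b := fun u z hz => by simp only [hqm u z hz]
  set S := (List.finite_length_le Ω m).toFinset
  have hS : ∀ w, ∃ s ∈ S, wordProb (fun w b => t * q w b) w = wordProb (fun w b => t * q w b) s :=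
    fun w => (htq.exists_wordProb_eq w).imp fun s hs => by simpa [S] using hs
  have hS0 : (0 : ℝ) < S.card := Nat.cast_pos.2 (Finset.card_pos.2 ⟨[], by simp [S]⟩)
  have ht1' : 0 < (1 - t)⁻¹ := inv_pos.2 (sub_pos.2 ht1)
  filter_upwards [eventually_mul_pow_card_phrases_le_exp (C := Fintype.card Ω)
    (D := 2 * Fintype.card Ω * (S.card * (1 - t)⁻¹)) (Nat.cast_pos.2 Fintype.card_pos)
    (by positivity) (half_pos hδ) ω] with n hn
  have hbound := wordProb_le_mul_wordProb_lzProb ht1 (fun w b => mul_nonneg ht0.le (hq w b))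
    (fun w => by rw [← Finset.mul_sum]; exact mul_le_of_le_one_right ht0.le (hsum w)) hS
    (history ω n)
  rw [wordProb_const_mul, length_history, ht_def, ← Real.exp_nat_mul] at hbound
  calc wordProb q [] (history ω n)
      = Real.exp (δ / 2 * n) * (Real.exp (n * -(δ / 2)) * wordProb q [] (history ω n)) := by
        rw [← mul_assoc, ← Real.exp_add, mul_neg, mul_comm (n : ℝ), add_neg_cancel, Real.exp_zero,
          one_mul]
    _ ≤ Real.exp (δ / 2 * n) * (Real.exp (δ / 2 * n) * wordProb lzProb [] (history ω n)) :=
        mul_le_mul_of_nonneg_left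
          (hbound.trans (mul_le_mul_of_nonneg_right hn (wordProb_lzProb_pos _).le))
          (Real.exp_pos _).le
    _ = Real.exp (δ * n) * wordProb lzProb [] (history ω n) := by
        rw [← mul_assoc, ← Real.exp_add, ← add_mul, add_halves]

end LempelZiv

section Tilting

lemma exp_sub_two_mul_sq_le {x : ℝ} (hx : -(1 / 2) ≤ x) : Real.exp (x - 2 * x ^ 2) ≤ 1 + x := by
  have hpos : 0 < 1 + x := by linarith
  rw [← Real.le_log_iff_exp_le hpos]
  refine le_trans ?_ (Real.one_sub_inv_le_log_of_pos hpos)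
  have hdiff : 1 - (1 + x)⁻¹ - (x - 2 * x ^ 2) = x ^ 2 * (1 + 2 * x) / (1 + x) := by
    field_simp
    ring
  rw [← sub_nonneg, hdiff]
  exact div_nonneg (mul_nonneg (sq_nonneg x) (by linarith)) hpos.le

lemma exp_mul_sub_two_mul_sq_le {x ε : ℝ} (hε : |ε| ≤ 1 / 2) (hx : |x| ≤ 1) :
    Real.exp (ε * x - 2 * ε ^ 2) ≤ 1 + ε * x := by
  have habs : |ε * x| ≤ 1 / 2 := by
    simpa [abs_mul] using mul_le_mul hε hx (abs_nonneg x) one_half_pos.le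
  have hsq : (ε * x) ^ 2 ≤ ε ^ 2 := by
    simpa [mul_pow] using mul_le_of_le_one_right (sq_nonneg ε) ((sq_le_one_iff_abs_le_one x).2 hx)
  exact (Real.exp_le_exp.2 (by linarith)).trans (exp_sub_two_mul_sq_le (neg_le_of_abs_le habs))

lemma exists_frequently_four_mul_sq_mul_le {X : ℕ → ℝ}
    (hX : ¬Tendsto (fun n : ℕ => (n : ℝ)⁻¹ * X n) atTop (𝓝 0)) :
    ∃ ε : ℝ, ε ≠ 0 ∧ |ε| ≤ 1 / 2 ∧ ∃ᶠ n : ℕ in atTop, 4 * ε ^ 2 * n ≤ ε * X n := by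
  obtain ⟨η, hη, hfreq⟩ : ∃ η > 0, ∃ᶠ n : ℕ in atTop, η ≤ |(n : ℝ)⁻¹ * X n| := by
    by_contra! hbound
    refine hX (Metric.tendsto_nhds.2 fun η hη => ?_)
    simpa only [Real.dist_eq, sub_zero] using hbound η hη
  set θ := min η 1 / 4 with hθ_def
  have hθ : 0 < θ := by positivity
  have hθη : 4 * θ ≤ η := by linarith [min_le_left η 1]
  have hθ1 : |θ| ≤ 1 / 2 := by rw [abs_of_pos hθ]; linarith [min_le_right η 1]
  have hfreq' : ∃ᶠ n : ℕ in atTop, 4 * θ * n ≤ X n ∨ 4 * θ * n ≤ -X n := by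
    refine hfreq.mono fun n hn => ?_
    rw [← le_abs]
    rw [abs_mul, abs_inv, Nat.abs_cast] at hn
    rcases n.cast_nonneg (α := ℝ) |>.eq_or_lt with hn0 | hn0
    · simp [← hn0]
    · calc 4 * θ * n ≤ η * n := by gcongr
        _ ≤ |X n| := by rwa [mul_comm, ← le_inv_mul_iff₀ hn0]
  rcases frequently_or_distrib.1 hfreq' with hpos | hneg
  · exact ⟨θ, hθ.ne', hθ1, hpos.mono fun n hn => by nlinarith⟩
  · exact ⟨-θ, neg_ne_zero.2 hθ.ne', by rwa [abs_neg], hneg.mono fun n hn => by nlinarith⟩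

variable {Ω : Type*} [DecidableEq Ω]

/-- The forecasts `p`, tilted in favour of (for `0 < ε`) or against (for `ε < 0`) the letter `a`
after the words that end with `y`. -/
noncomputable def tilt (p : List Ω → Ω → ℝ) (y : List Ω) (a : Ω) (ε : ℝ) (w : List Ω) (b : Ω) : ℝ :=
  p w b * (1 + ε * excess p y a w b)

lemma IsMarkovian.tilt {m : ℕ} {p : List Ω → Ω → ℝ} (hpm : IsMarkovian m p) {y : List Ω}
    (hy : m ≤ y.length) (a : Ω) (ε : ℝ) : IsMarkovian y.length (tilt p y a ε) := by
  intro u z hz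
  have hsuf : y <:+ u ++ z ↔ y <:+ z :=
    ⟨fun h => List.suffix_of_suffix_length_le h (List.suffix_append u z) hz,
      fun h => h.trans (List.suffix_append u z)⟩
  ext b
  simp only [PredictiveGame.tilt, excess, hpm u z (hy.trans hz), hsuf]

variable [Fintype Ω] {p : List Ω → Ω → ℝ}

lemma IsForecast.le_one {Ω : Type*} [Fintype Ω] {q : Ω → ℝ} (hq : IsForecast q) (a : Ω) :
    q a ≤ 1 := by
  rw [← hq.2]
  exact Finset.single_le_sum (fun b _ => (hq.1 b).le) (Finset.mem_univ a)

lemma abs_excess_le_one (hp : ∀ w, IsForecast (p w)) (y : List Ω) (a : Ω) (w : List Ω) (x : Ω) :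
    |excess p y a w x| ≤ 1 := by
  have hpos := (hp w).1 a
  have hle := (hp w).le_one a
  rw [excess, abs_le]
  split_ifs <;> constructor <;> linarith

lemma exp_le_one_add_mul_excess (hp : ∀ w, IsForecast (p w)) (y : List Ω) (a : Ω) {ε : ℝ}
    (hε : |ε| ≤ 1 / 2) (w : List Ω) (x : Ω) :
    Real.exp (ε * excess p y a w x - 2 * ε ^ 2) ≤ 1 + ε * excess p y a w x :=
  exp_mul_sub_two_mul_sq_le hε (abs_excess_le_one hp y a w x)

lemma tilt_nonneg (hp : ∀ w, IsForecast (p w)) (y : List Ω) (a : Ω) {ε : ℝ} (hε : |ε| ≤ 1 / 2)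
    (w : List Ω) (b : Ω) : 0 ≤ tilt p y a ε w b :=
  mul_nonneg ((hp w).1 b).le
    ((Real.exp_pos _).le.trans (exp_le_one_add_mul_excess hp y a hε w b))

lemma sum_tilt {w : List Ω} (hp : ∑ b, p w b = 1) (y : List Ω) (a : Ω) (ε : ℝ) :
    ∑ b, tilt p y a ε w b = 1 := by
  have hfair : ∑ b, p w b * excess p y a w b = 0 := by
    unfold excess
    split_ifs
    · simp only [mul_sub, Finset.sum_sub_distrib, ← Finset.sum_mul, hp]
      simp
    · simp
  simp only [tilt, mul_add, mul_one, mul_left_comm _ ε, Finset.sum_add_distrib, ← Finset.mul_sum,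
    hfair, hp, mul_zero, add_zero]

lemma wordProb_mul_exp_le_wordProb_tilt (hp : ∀ w, IsForecast (p w)) (y : List Ω) (a : Ω) {ε : ℝ}
    (hε : |ε| ≤ 1 / 2) (ω : ℕ → Ω) (n : ℕ) :
    wordProb p [] (history ω n) * Real.exp (ε * ∑ i ∈ Finset.range n,
      excess p y a (history ω i) (ω i) - 2 * ε ^ 2 * n) ≤
        wordProb (tilt p y a ε) [] (history ω n) := by
  have hexp : ε * ∑ i ∈ Finset.range n, excess p y a (history ω i) (ω i) - 2 * ε ^ 2 * n =
      ∑ i ∈ Finset.range n, (ε * excess p y a (history ω i) (ω i) - 2 * ε ^ 2) := by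
    simp [Finset.sum_sub_distrib, Finset.mul_sum, mul_comm]
  rw [wordProb_history (tilt p y a ε), hexp, Real.exp_sum]
  simp only [tilt, Finset.prod_mul_distrib, ← wordProb_history]
  exact mul_le_mul_of_nonneg_left
    (Finset.prod_le_prod (fun i _ => (Real.exp_pos _).le) fun i _ =>
      exp_le_one_add_mul_excess hp y a hε _ _)
    (wordProb_nonneg (fun w b => ((hp w).1 b).le) _ _)

theorem frequently_lt_wordProb_lzProb_div {m : ℕ} (hp : ∀ w, IsForecast (p w))
    (hpm : IsMarkovian m p) {y : List Ω} (hy : m ≤ y.length) {a : Ω} {ω : ℕ → Ω}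
    (hexcess : ¬Tendsto (meanExcess p y a ω) atTop (𝓝 0)) (B : ℝ) :
    ∃ᶠ n : ℕ in atTop,
      B < wordProb lzProb [] (history ω n) / wordProb p [] (history ω n) := by
  have : Nonempty Ω := ⟨a⟩
  obtain ⟨ε, hε0, hε, hfreq⟩ := exists_frequently_four_mul_sq_mul_le hexcess
  have hε2 : 0 < ε ^ 2 := by positivity
  have hlz := eventually_wordProb_le_exp_mul_wordProb_lzProb (tilt_nonneg hp y a hε)
    (fun w => (sum_tilt (hp w).2 y a ε).le) (hpm.tilt hy a ε) hε2 ω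
  have hbig : ∀ᶠ n : ℕ in atTop, B < Real.exp (ε ^ 2 * n) :=
    (Real.tendsto_exp_atTop.comp
      (tendsto_natCast_atTop_atTop.const_mul_atTop hε2)).eventually_gt_atTop B
  refine (hfreq.and_eventually (hlz.and hbig)).mono fun n ⟨hdev, hlz, hbig⟩ => hbig.trans_le ?_
  have hpos := wordProb_pos (fun w b => (hp w).1 b) [] (history ω n)
  rw [le_div_iff₀ hpos]
  refine le_of_mul_le_mul_left ?_ (Real.exp_pos (ε ^ 2 * n))
  calc Real.exp (ε ^ 2 * n) * (Real.exp (ε ^ 2 * n) * wordProb p [] (history ω n))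
      = wordProb p [] (history ω n) * Real.exp (4 * ε ^ 2 * n - 2 * ε ^ 2 * n) := by
        rw [← mul_assoc, ← Real.exp_add, mul_comm]
        ring_nf
    _ ≤ wordProb p [] (history ω n) * Real.exp (ε * ∑ i ∈ Finset.range n,
          excess p y a (history ω i) (ω i) - 2 * ε ^ 2 * n) := by gcongr
    _ ≤ wordProb (tilt p y a ε) [] (history ω n) :=
        wordProb_mul_exp_le_wordProb_tilt hp y a hε ω n
    _ ≤ Real.exp (ε ^ 2 * n) * wordProb lzProb [] (history ω n) := hlz

end Tilting

section Banking

variable {Ω : Type*} [Fintype Ω] [DecidableEq Ω] {p α : List Ω → Ω → ℝ}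

lemma capital_pos (hgain : ∀ w x, 0 < gain p α w x) (ω : ℕ → Ω) (n : ℕ) :
    0 < capital p α ω n := by
  induction n with
  | zero => exact one_pos
  | succ n ih => exact mul_pos ih (hgain _ _)

lemma accounts_past (p α : List Ω → Ω → ℝ) (w : List Ω) : (accounts p α w).past = w := by
  induction w using List.reverseRecOn with
  | nil => rfl
  | append_singleton w x ih =>
    rw [accounts, List.foldl_concat, ← accounts, Accounts.step]
    split_ifs <;> simp only [ih]

lemma accounts_append_singleton (p α : List Ω → Ω → ℝ) (w : List Ω) (x : Ω) :
    accounts p α (w ++ [x]) =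
      if 2 ≤ (accounts p α w).active * gain p α w x then
        ⟨w ++ [x], 1, (accounts p α w).storage + ((accounts p α w).active * gain p α w x - 1)⟩
      else ⟨w ++ [x], (accounts p α w).active * gain p α w x, (accounts p α w).storage⟩ := by
  rw [accounts, List.foldl_concat, ← accounts, Accounts.step, accounts_past]

lemma accounts_active_pos (hgain : ∀ w x, 0 < gain p α w x) (w : List Ω) :
    0 < (accounts p α w).active := by
  induction w using List.reverseRecOn with
  | nil => exact one_pos
  | append_singleton w x ih =>
    rw [accounts_append_singleton]
    split_ifs
    · exact one_pos
    · exact mul_pos ih (hgain _ _)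

lemma accounts_storage_add_one_le {w : List Ω} {x : Ω}
    (h : 2 ≤ (accounts p α w).active * gain p α w x) :
    (accounts p α w).storage + 1 ≤ (accounts p α (w ++ [x])).storage := by
  rw [accounts_append_singleton, if_pos h]
  dsimp only
  linarith

lemma monotone_storage (p α : List Ω → Ω → ℝ) (ω : ℕ → Ω) :
    Monotone fun n => (accounts p α (history ω n)).storage := by
  refine monotone_nat_of_le_succ fun n => ?_
  rw [history_succ]
  by_cases h : 2 ≤ (accounts p α (history ω n)).active * gain p α (history ω n) (ω n)
  · linarith [accounts_storage_add_one_le h]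
  · rw [accounts_append_singleton, if_neg h]

lemma storage_nonneg (p α : List Ω → Ω → ℝ) (ω : ℕ → Ω) (n : ℕ) :
    0 ≤ (accounts p α (history ω n)).storage :=
  monotone_storage p α ω n.zero_le

lemma accounts_active_add_storage (p α : List Ω → Ω → ℝ) (w : List Ω) (x : Ω) :
    (accounts p α (w ++ [x])).active + (accounts p α (w ++ [x])).storage =
      (accounts p α w).active * gain p α w x + (accounts p α w).storage := by
  rw [accounts_append_singleton]
  split_ifs
  · dsimp only
    ring
  · rfl

lemma gain_banked (p α : List Ω → Ω → ℝ) (w : List Ω) (x : Ω) :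
    gain p (banked p α) w x = 1 + (accounts p α w).active /
      ((accounts p α w).active + (accounts p α w).storage) * (gain p α w x - 1) := by
  simp only [gain, banked, add_sub_cancel_left, Finset.mul_sum, mul_assoc]

lemma capital_banked (hgain : ∀ w x, 0 < gain p α w x) (ω : ℕ → Ω) (n : ℕ) :
    capital p (banked p α) ω n =
      (accounts p α (history ω n)).active + (accounts p α (history ω n)).storage := by
  induction n with
  | zero => simp [capital, history, accounts]
  | succ n ih =>
    have hstorage := storage_nonneg p α ω n
    have hactive := accounts_active_pos hgain (history ω n)
    rw [capital, ih, gain_banked, history_succ, accounts_active_add_storage]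
    field_simp
    ring

lemma isPrudent_banked (hgain : ∀ w x, 0 < gain p α w x) : IsPrudent p (banked p α) := by
  intro ω n
  rw [capital_banked hgain]
  exact add_pos_of_pos_of_nonneg (accounts_active_pos hgain _) (storage_nonneg p α ω n)

lemma accounts_active_mul_capital {ω : ℕ → Ω} {m : ℕ}
    (h : ∀ n, m ≤ n → (accounts p α (history ω n)).active * gain p α (history ω n) (ω n) < 2)
    {n : ℕ} (hn : m ≤ n) :
    (accounts p α (history ω n)).active * capital p α ω m =
      (accounts p α (history ω m)).active * capital p α ω n := by
  induction n, hn using Nat.le_induction with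
  | base => rfl
  | succ n hn ih =>
    rw [history_succ, accounts_append_singleton, if_neg (h n hn).not_ge, capital, ← mul_assoc, ← ih]
    ring

lemma frequently_two_le_active_mul_gain (hgain : ∀ w x, 0 < gain p α w x) {ω : ℕ → Ω}
    (hunbdd : ∀ B, ∃ᶠ n in atTop, B < capital p α ω n) :
    ∃ᶠ n in atTop,
      2 ≤ (accounts p α (history ω n)).active * gain p α (history ω n) (ω n) := by
  intro hev
  obtain ⟨m, hm⟩ := eventually_atTop.1 hev
  simp only [not_le] at hm
  have hactive := accounts_active_pos hgain (history ω m)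
  have hbdd : ∀ n, m + 1 ≤ n →
      capital p α ω n ≤ 2 * capital p α ω m / (accounts p α (history ω m)).active := by
    intro n hn
    obtain ⟨n, rfl⟩ := Nat.exists_eq_add_of_le' hn
    have hle : (accounts p α (history ω (n + (m + 1)))).active ≤ 2 := by
      rw [← add_assoc, history_succ, accounts_append_singleton,
        if_neg (hm (n + m) (by lia)).not_ge]
      exact (hm (n + m) (by lia)).le
    rw [le_div_iff₀' hactive, ← accounts_active_mul_capital hm (by lia)]
    exact mul_le_mul_of_nonneg_right hle (capital_pos hgain ω m).le
  obtain ⟨n, hlt, hn⟩ := ((hunbdd _).and_eventually (eventually_ge_atTop (m + 1))).exists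
  exact (hbdd n hn).not_gt hlt

lemma tendsto_atTop_of_frequently_add_one_le {u : ℕ → ℝ} (hu : Monotone u)
    (hfreq : ∃ᶠ n in atTop, u n + 1 ≤ u (n + 1)) : Tendsto u atTop atTop := by
  refine (tendsto_atTop_of_monotone hu).resolve_right ?_
  rintro ⟨l, hl⟩
  have hdiff : Tendsto (fun n => u (n + 1) - u n) atTop (𝓝 0) := by
    simpa using (hl.comp (tendsto_add_atTop_nat 1)).sub hl
  refine hfreq ((hdiff.eventually_lt_const one_pos).mono fun n hn => ?_)
  linarith

lemma tendsto_capital_banked (hgain : ∀ w x, 0 < gain p α w x) {ω : ℕ → Ω}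
    (hunbdd : ∀ B, ∃ᶠ n in atTop, B < capital p α ω n) :
    Tendsto (capital p (banked p α) ω) atTop atTop := by
  have hstorage : Tendsto (fun n => (accounts p α (history ω n)).storage) atTop atTop := by
    refine tendsto_atTop_of_frequently_add_one_le (monotone_storage p α ω) ?_
    refine (frequently_two_le_active_mul_gain hgain hunbdd).mono fun n hn => ?_
    rw [history_succ]
    exact accounts_storage_add_one_le hn
  refine tendsto_atTop_mono (fun n => ?_) hstorage
  rw [capital_banked hgain]
  exact le_add_of_nonneg_left (accounts_active_pos hgain _).le

end Banking

section Strategies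

variable {Ω : Type*} [Fintype Ω] [DecidableEq Ω] {k : ℕ} {p q α : List Ω → Ω → ℝ}

lemma gain_lzStrategy {w : List Ω} (hp : ∀ a, 0 < p w a) (x : Ω) :
    gain p (lzStrategy p) w x = lzProb w x / p w x := by
  have : Nonempty Ω := ⟨x⟩
  have hcancel : ∀ a, lzProb w a / p w a * p w a = lzProb w a := fun a =>
    div_mul_cancel₀ _ (hp a).ne'
  simp [gain, lzStrategy, mul_sub, Finset.sum_sub_distrib, hcancel, (isForecast_lzProb w).2]

lemma gain_lzStrategy_pos {w : List Ω} (hp : ∀ a, 0 < p w a) (x : Ω) :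
    0 < gain p (lzStrategy p) w x := by
  have : Nonempty Ω := ⟨x⟩
  rw [gain_lzStrategy hp]
  exact div_pos ((isForecast_lzProb w).1 x) (hp x)

lemma capital_lzStrategy (hp : ∀ w a, 0 < p w a) (ω : ℕ → Ω) (n : ℕ) :
    capital p (lzStrategy p) ω n =
      wordProb lzProb [] (history ω n) / wordProb p [] (history ω n) := by
  induction n with
  | zero => simp [capital, history, wordProb_nil]
  | succ n ih =>
    rw [capital, ih, gain_lzStrategy (hp _), history_succ, wordProb_append_singleton,
      wordProb_append_singleton, div_mul_div_comm]

variable {M : Ω → (Fin k → Ω) → ℝ} {π : (Fin k → Ω) → ℝ}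

theorem ensures_banked_lzStrategy (hM : IsKernel M) (hπ : IsStationary M π)
    (hp : FollowsKernel M p) : Ensures p (banked p (lzStrategy p)) (IsNormal M π) := by
  have hpos : ∀ w a, 0 < p w a := fun w => (hp.1 w).1
  have hgain : ∀ w x, 0 < gain p (lzStrategy p) w x := fun w => gain_lzStrategy_pos (hpos w)
  refine ⟨isPrudent_banked hgain, fun ω hω => tendsto_capital_banked hgain fun B => ?_⟩
  obtain ⟨y, a, hy, hexcess⟩ : ∃ y a, k ≤ y.length ∧
      ¬Tendsto (meanExcess p y a ω) atTop (𝓝 0) := by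
    by_contra! hlim
    exact hω (isNormal_of_tendsto_excess hM hπ hp hlim)
  simpa only [capital_lzStrategy hpos] using
    frequently_lt_wordProb_lzProb_div hp.1 hp.isMarkovian hy hexcess B

lemma gain_eq_one_of_forall_eq {w : List Ω} (hp : ∑ a, p w a = 1) {r : ℝ} (hα : ∀ a, α w a = r)
    (x : Ω) : gain p α w x = 1 := by
  simp [gain, hα, ← Finset.mul_sum, Finset.sum_sub_distrib, hp]

lemma Ensures.congr_gain {E : (ℕ → Ω) → Prop} (hq : Ensures q α E)
    (hgain : ∀ w x, gain p α w x = gain q α w x) : Ensures p α E := by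
  have hcapital : capital p α = capital q α := by
    ext ω n
    induction n with
    | zero => rfl
    | succ n ih => rw [capital, capital, ih, hgain]
  rwa [Ensures, IsPrudent, hcapital]

/-- The forecasts given by the kernel, preceded by Lempel–Ziv probabilities: the Lempel–Ziv strategy
against them does not bet in the first `k` rounds. -/
noncomputable def lzKernelForecast (M : Ω → (Fin k → Ω) → ℝ) (w : List Ω) (a : Ω) : ℝ :=
  if h : k ≤ w.length then M a fun j => w[w.length - k + j] else lzProb w a

variable [Nonempty Ω]

lemma followsKernel_lzKernelForecast (hM : IsKernel M) : FollowsKernel M (lzKernelForecast M) := by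
  refine ⟨fun w => ?_, fun u v a => ?_⟩
  · by_cases h : k ≤ w.length
    · have hw : lzKernelForecast M w = fun a => M a fun j => w[w.length - k + j] :=
        funext fun a => dif_pos h
      exact hw ▸ hM _
    · have hw : lzKernelForecast M w = lzProb w := funext fun a => dif_neg h
      exact hw ▸ isForecast_lzProb w
  · simp [lzKernelForecast]

lemma lzStrategy_lzKernelForecast {w : List Ω} (hw : w.length < k) (a : Ω) :
    lzStrategy (lzKernelForecast M) w a = 1 := by
  rw [lzStrategy, lzKernelForecast, dif_neg hw.not_ge]
  exact div_self ((isForecast_lzProb w).1 a).ne'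

-- A strategy that stakes the same amount on every letter is not affected by the forecast, so the
-- banked Lempel–Ziv strategy against `lzKernelForecast M` does equally well against any forecasts
-- that follow `M`.
theorem exists_ensures_isNormal (hM : IsKernel M) (hπ : IsStationary M π) :
    ∃ α : List Ω → Ω → ℝ, ∀ p : List Ω → Ω → ℝ, FollowsKernel M p →
      Ensures p α (IsNormal M π) := by
  have hq := followsKernel_lzKernelForecast hM
  refine ⟨banked (lzKernelForecast M) (lzStrategy (lzKernelForecast M)), fun p hp =>
    (ensures_banked_lzStrategy hM hπ hq).congr_gain fun w x => ?_⟩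
  rcases le_or_gt k w.length with hw | hw
  · simp only [gain, hp.apply_eq hq hw]
  · have hconst : ∀ a, banked (lzKernelForecast M) (lzStrategy (lzKernelForecast M)) w a =
        banked (lzKernelForecast M) (lzStrategy (lzKernelForecast M)) w x := fun a => by
      rw [banked, banked, lzStrategy_lzKernelForecast hw, lzStrategy_lzKernelForecast hw]
    rw [gain_eq_one_of_forall_eq (hp.1 w).2 hconst, gain_eq_one_of_forall_eq (hq.1 w).2 hconst]

end Strategies

end PredictiveGame

theorem mainTheorem1 {Ω : Type*} [Fintype Ω] [DecidableEq Ω] [Nonempty Ω] (k : ℕ)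
    (M : Ω → (Fin k → Ω) → ℝ) (hM : PredictiveGame.IsKernel M) :
    ∃ π : (Fin k → Ω) → ℝ,
      -- `π` is the stationary distribution of `M`, and it is strictly positive
      (PredictiveGame.IsStationary M π ∧ (∀ v, 0 < π v) ∧
        ∀ π' : (Fin k → Ω) → ℝ, PredictiveGame.IsStationary M π' → π' = π) ∧
      -- one strategy, depending on Reality's past moves only, serves against every Forecaster
      (∃ α : List Ω → Ω → ℝ, ∀ p : List Ω → Ω → ℝ, PredictiveGame.FollowsKernel M p →
        PredictiveGame.Ensures p α (PredictiveGame.IsNormal M π)) ∧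
      -- the Lempel–Ziv betting strategy with banked gains is such a strategy
      (∀ p : List Ω → Ω → ℝ, PredictiveGame.FollowsKernel M p →
        PredictiveGame.Ensures p (PredictiveGame.banked p (PredictiveGame.lzStrategy p))
          (PredictiveGame.IsNormal M π)) := by
  obtain ⟨π, hπ⟩ := PredictiveGame.exists_isStationary hM
  exact ⟨π, ⟨hπ, hπ.pos hM, fun π' hπ' => hπ.unique hM hπ'⟩,
    PredictiveGame.exists_ensures_isNormal hM hπ,
    fun p hp => PredictiveGame.ensures_banked_lzStrategy hM hπ hp⟩
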